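/- Let $n\ge 0$ be an integer (the case $n\ge 1$ is the one of interest) and let $M$ be a smooth $n$-dimensional manifold diffeomorphic to the Euclidean sphere $S^n$. Let $f:M\to\mathbb R^{n+1}$ be a smooth immersion equipped with a smooth transversal vector field $\xi$ that is a centroaffine normalization: there are a point $c\in\mathbb R^{n+1}$ (the center) and a constant $a\neq 0$ such that $\xi_x=a\,(f(x)-c)$ and $\xi_x\notin f_*(T_xM)$ for all $x\in M$. The induced connection $\nabla$ and the second fundamental form $g$ are defined by the Gauss formula $$D_X f_*Y=f_*\nabla_XY+g(X,Y)\,\xi ,$$ where $D$ is the standard flat connection of $\mathbb R^{n+1}$. Assume that $g$ is non-degenerate at every point (so that $f$ is a centroaffine ovaloid). Then $\nabla$ is geodesically complete. Moreover, the dual connection $\overline\nabla$, that is, the connection on $M$ characterized by $$X\,g(Y,Z)=g(\nabla_XY,Z)+g(Y,\overline\nabla_XZ)$$ for all vector fields $X,Y,Z$, exists and is geodesically complete. Here a connection on $M$ is geodesically complete if for every $x\in M$ and $v\in T_xM$ there is a geodesic $\gamma:\mathbb R\to M$, defined on the whole real line, with $\gamma(0)=x$ and $\gamma'(0)=v$.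 -/

import Mathlib

open Bundle Manifold
open scoped ContDiff Manifold

noncomputable section

/-! ### Geodesics and completeness of a connection on the tangent bundle -/

section Geodesics

variable {E : Type*} [NormedAddCommGroup E] [NormedSpace ℝ E]
  {H : Type*} [TopologicalSpace H] {I : ModelWithCorners ℝ E H}
  {M : Type*} [TopologicalSpace M] [ChartedSpace H M] [IsManifold I 1 M]

/-- The velocity vector `γ'(t)` of a curve in a manifold. -/
def curveVelocity (I : ModelWithCorners ℝ E H) (γ : ℝ → M) (t : ℝ) : TangentSpace I (γ t) :=
  mfderiv 𝓘(ℝ, ℝ) I γ t (1 : ℝ)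

/-- The covariant derivative `(D V / dt)(t)` of a vector field `V` along a curve `γ`.
In the coordinates `e` of the tangent bundle given by the chart at `γ t`, it is
`v'(t) + Γ(γ'(t), v(t))`, where `v` is the coordinate expression of `V` and where
`Γ(X, w) = ∇_X W` for the vector field `W` near `γ t` whose coordinates are constantly `w`
(this is `FiberBundle.extend E (V t)`). -/
def covDerivAlong (cov : CovariantDerivative I E (TangentSpace I : M → Type _))
    (γ : ℝ → M) (V : ∀ t, TangentSpace I (γ t)) (t : ℝ) : TangentSpace I (γ t) :=
  let e := trivializationAt E (TangentSpace I : M → Type _) (γ t)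
  e.symm (γ t) (deriv (fun s => (e ⟨γ s, V s⟩).2) t)
    + cov (FiberBundle.extend E (V t)) (γ t) (curveVelocity I γ t)

/-- A curve defined on the whole real line is a geodesic (affinely parametrized) of `cov` if it
is smooth and `∇_{γ'} γ' = 0` along it. -/
def IsGeodesic (cov : CovariantDerivative I E (TangentSpace I : M → Type _)) (γ : ℝ → M) : Prop :=
  ContMDiff 𝓘(ℝ, ℝ) I ∞ γ ∧ ∀ t, covDerivAlong cov γ (curveVelocity I γ) t = 0

/-- Geodesic completeness: for every point and every initial velocity there is a geodesic with
these initial data whose affine parameter runs over the whole real line. -/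
def IsGeodesicallyComplete (cov : CovariantDerivative I E (TangentSpace I : M → Type _)) : Prop :=
  ∀ (x : M) (v : TangentSpace I x), ∃ γ : ℝ → M, IsGeodesic cov γ ∧
    (⟨γ 0, curveVelocity I γ 0⟩ : TangentBundle I M) = ⟨x, v⟩

/-- `cov'` is dual (conjugate) to `cov` with respect to the field `g` of bilinear forms:
`X g(Y, Z) = g(∇_X Y, Z) + g(Y, ∇'_X Z)` for all vector fields. -/
def IsDualConnection (g : ∀ x : M, TangentSpace I x →L[ℝ] TangentSpace I x →L[ℝ] ℝ)
    (cov cov' : CovariantDerivative I E (TangentSpace I : M → Type _)) : Prop :=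
  ∀ (x : M) (X : TangentSpace I x) (Y Z : ∀ y : M, TangentSpace I y),
    MDiffAt (T% Y) x → MDiffAt (T% Z) x →
      mvfderiv I (fun y => g y (Y y) (Z y)) x X = g x (cov Y x X) (Z x) + g x (Y x) (cov' Z x X)

end Geodesics

/-! ### Affine hypersurfaces -/

/-- An immersed hypersurface `f : M → ℝⁿ⁺¹` equipped with a transversal vector field `ξ`. -/
structure AffineHypersurface (n : ℕ) (M : Type*) [TopologicalSpace M]
    [ChartedSpace (EuclideanSpace ℝ (Fin n)) M] where
  /-- the immersion -/
  f : M → EuclideanSpace ℝ (Fin (n + 1))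
  /-- the transversal vector field -/
  ξ : M → EuclideanSpace ℝ (Fin (n + 1))
  smooth_f : ContMDiff (𝓡 n) 𝓘(ℝ, EuclideanSpace ℝ (Fin (n + 1))) ∞ f
  smooth_ξ : ContMDiff (𝓡 n) 𝓘(ℝ, EuclideanSpace ℝ (Fin (n + 1))) ∞ ξ
  immersion : ∀ x, Function.Injective (mvfderiv (𝓡 n) f x)
  transversal : ∀ x, ξ x ∉ Set.range (mvfderiv (𝓡 n) f x)

namespace AffineHypersurface

variable {n : ℕ} {M : Type*} [TopologicalSpace M] [ChartedSpace (EuclideanSpace ℝ (Fin n)) M]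
  (S : AffineHypersurface n M)

/-- The differential `f_* : T_x M → ℝⁿ⁺¹`. -/
def push (x : M) : TangentSpace (𝓡 n) x →L[ℝ] EuclideanSpace ℝ (Fin (n + 1)) :=
  mvfderiv (𝓡 n) S.f x

/-- The linear map `(v, a) ↦ f_* v + a ξ_x` from `T_x M × ℝ` to `ℝⁿ⁺¹`. -/
def splitMap (x : M) : (TangentSpace (𝓡 n) x × ℝ) →ₗ[ℝ] EuclideanSpace ℝ (Fin (n + 1)) :=
  LinearMap.coprod (S.push x).toLinearMap (LinearMap.toSpanSingleton ℝ _ (S.ξ x))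

lemma splitMap_apply (x : M) (v : TangentSpace (𝓡 n) x) (a : ℝ) :
    S.splitMap x (v, a) = S.push x v + a • S.ξ x := by
  simp [splitMap]

lemma splitMap_injective (x : M) : Function.Injective (S.splitMap x) := by
  rw [injective_iff_map_eq_zero]
  rintro ⟨v, a⟩ h
  rw [splitMap_apply] at h
  have ha : a = 0 := by
    by_contra ha
    refine S.transversal x ⟨-(a⁻¹ • v), ?_⟩
    change S.push x (-(a⁻¹ • v)) = _
    have h2 : S.push x v = -(a • S.ξ x) := eq_neg_of_add_eq_zero_left h
    rw [map_neg, map_smul, h2, smul_neg, neg_neg, smul_smul, inv_mul_cancel₀ ha, one_smul]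
  subst ha
  have hv : S.push x v = S.push x 0 := by simpa using h
  have : v = 0 := S.immersion x hv
  simp [this]

lemma splitMap_bijective (x : M) : Function.Bijective (S.splitMap x) := by
  have : FiniteDimensional ℝ (TangentSpace (𝓡 n) x) :=
    inferInstanceAs (FiniteDimensional ℝ (EuclideanSpace ℝ (Fin n)))
  have h : Module.finrank ℝ (TangentSpace (𝓡 n) x) = n :=
    finrank_euclideanSpace_fin (𝕜 := ℝ) (n := n)
  exact ⟨S.splitMap_injective x, (LinearMap.injective_iff_surjective_of_finrank_eq_finrank
    (by simp [Module.finrank_prod, h])).1 (S.splitMap_injective x)⟩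

/-- The decomposition `ℝⁿ⁺¹ = f_*(T_x M) ⊕ ℝ ξ_x`. -/
def split (x : M) : (TangentSpace (𝓡 n) x × ℝ) ≃ₗ[ℝ] EuclideanSpace ℝ (Fin (n + 1)) :=
  LinearEquiv.ofBijective (S.splitMap x) (S.splitMap_bijective x)

/-- The tangential component: `w = f_* (tangentPart w) + (transversalPart w) ξ_x`. -/
def tangentPart (x : M) : EuclideanSpace ℝ (Fin (n + 1)) →L[ℝ] TangentSpace (𝓡 n) x :=
  LinearMap.toContinuousLinearMap (LinearMap.fst ℝ _ _ ∘ₗ (S.split x).symm.toLinearMap)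

/-- The transversal component: `w = f_* (tangentPart w) + (transversalPart w) ξ_x`. -/
def transversalPart (x : M) : EuclideanSpace ℝ (Fin (n + 1)) →L[ℝ] ℝ :=
  LinearMap.toContinuousLinearMap (LinearMap.snd ℝ _ _ ∘ₗ (S.split x).symm.toLinearMap)

lemma split_eq (x : M) (w : EuclideanSpace ℝ (Fin (n + 1))) :
    S.push x (S.tangentPart x w) + S.transversalPart x w • S.ξ x = w := by
  have h : S.splitMap x ((S.split x).symm w) = w := by
    exact (S.split x).apply_symm_apply w
  conv_rhs => rw [← h]
  exact (S.splitMap_apply x _ _).symm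

lemma split_symm_push (x : M) (v : TangentSpace (𝓡 n) x) :
    (S.split x).symm (S.push x v) = (v, 0) := by
  rw [LinearEquiv.symm_apply_eq]
  exact (by simp [splitMap_apply] : S.push x v = S.splitMap x (v, 0))

@[simp] lemma tangentPart_push (x : M) (v : TangentSpace (𝓡 n) x) :
    S.tangentPart x (S.push x v) = v :=
  congrArg Prod.fst (S.split_symm_push x v)

@[simp] lemma transversalPart_push (x : M) (v : TangentSpace (𝓡 n) x) :
    S.transversalPart x (S.push x v) = 0 :=
  congrArg Prod.snd (S.split_symm_push x v)

/-- The vector field `f_* Y` along `f`. -/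
def pushField (Y : ∀ y : M, TangentSpace (𝓡 n) y) (y : M) : EuclideanSpace ℝ (Fin (n + 1)) :=
  S.push y (Y y)

lemma pushField_add (Y Z : ∀ y : M, TangentSpace (𝓡 n) y) :
    S.pushField (Y + Z) = S.pushField Y + S.pushField Z := by
  ext1 y; simp [pushField]

lemma pushField_smul (a : M → ℝ) (Y : ∀ y : M, TangentSpace (𝓡 n) y) :
    S.pushField (a • Y) = a • S.pushField Y := by
  ext1 y; simp [pushField]

variable [IsManifold (𝓡 n) ∞ M]

lemma mdiffAt_pushField {Y : ∀ y : M, TangentSpace (𝓡 n) y} {x : M}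
    (hY : MDifferentiableAt (𝓡 n) ((𝓡 n).prod 𝓘(ℝ, EuclideanSpace ℝ (Fin n)))
      (fun y => TotalSpace.mk' (EuclideanSpace ℝ (Fin n)) y (Y y)) x) :
    MDifferentiableAt (𝓡 n) 𝓘(ℝ, EuclideanSpace ℝ (Fin (n + 1))) (S.pushField Y) x := by
  have h1 : ContMDiff (𝓡 n).tangent 𝓘(ℝ, EuclideanSpace ℝ (Fin (n + 1))).tangent 1
      (tangentMap (𝓡 n) 𝓘(ℝ, EuclideanSpace ℝ (Fin (n + 1))) S.f) :=
    S.smooth_f.contMDiff_tangentMap (by norm_cast)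
  have h2 := contMDiff_snd_tangentBundle_modelSpace
    (EuclideanSpace ℝ (Fin (n + 1))) 𝓘(ℝ, EuclideanSpace ℝ (Fin (n + 1))) (n := 1)
  exact ((h2.comp h1).mdifferentiableAt (by simp)).comp x hY

/-- The induced connection: `∇_X Y` is the tangential component of `D_X (f_* Y)`. -/
def inducedConnection : CovariantDerivative (𝓡 n) (EuclideanSpace ℝ (Fin n))
    (TangentSpace (𝓡 n) : M → Type _) where
  toFun Y x := S.tangentPart x ∘L mvfderiv (𝓡 n) (S.pushField Y) x
  isCovariantDerivativeOnUniv :=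
    { add := by
        intro Y Z x hY hZ _
        rw [pushField_add, mvfderiv_add (S.mdiffAt_pushField hY) (S.mdiffAt_pushField hZ)]
        ext1 v
        simp
      leibniz := by
        intro Y a x hY ha _
        rw [pushField_smul, mvfderiv_smul ha (S.mdiffAt_pushField hY)]
        ext1 v
        simp [pushField] }

lemma tensorialAt_transversal (x : M) :
    TensorialAt (𝓡 n) (EuclideanSpace ℝ (Fin n))
      (fun Y : ∀ y : M, TangentSpace (𝓡 n) y =>
        S.transversalPart x ∘L mvfderiv (𝓡 n) (S.pushField Y) x) x where
  smul {a Y} ha hY := by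
    rw [pushField_smul, mvfderiv_smul ha (S.mdiffAt_pushField hY)]
    ext1 v
    simp [pushField]
  add {Y Z} hY hZ := by
    rw [pushField_add, mvfderiv_add (S.mdiffAt_pushField hY) (S.mdiffAt_pushField hZ)]
    ext1 v
    simp

/-- The second fundamental form: `g(X, Y)` is the transversal component of `D_X (f_* Y)`, which
depends only on the values of `X` and `Y` at the point. (The first argument of the map below is
the differentiated field `Y`; the form is symmetric.) -/
def secondFundamentalForm (x : M) :
    TangentSpace (𝓡 n) x →L[ℝ] TangentSpace (𝓡 n) x →L[ℝ] ℝ :=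
  haveI : IsManifold (𝓡 n) 1 M := .of_le (n := ∞) (by norm_cast)
  TensorialAt.mkHom _ x (S.tensorialAt_transversal x)

/-- The Gauss formula `D_X (f_* Y) = f_* (∇_X Y) + g(X, Y) ξ`. -/
theorem gauss_formula {x : M} (X : TangentSpace (𝓡 n) x) {Y : ∀ y : M, TangentSpace (𝓡 n) y}
    (hY : MDifferentiableAt (𝓡 n) ((𝓡 n).prod 𝓘(ℝ, EuclideanSpace ℝ (Fin n)))
      (fun y => TotalSpace.mk' (EuclideanSpace ℝ (Fin n)) y (Y y)) x) :
    mvfderiv (𝓡 n) (fun y => mvfderiv (𝓡 n) S.f y (Y y)) x X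
      = mvfderiv (𝓡 n) S.f x (S.inducedConnection Y x X)
        + S.secondFundamentalForm x (Y x) X • S.ξ x := by
  have : IsManifold (𝓡 n) 1 M := .of_le (n := ∞) (by norm_cast)
  have h : S.secondFundamentalForm x (Y x) X
      = S.transversalPart x (mvfderiv (𝓡 n) (S.pushField Y) x X) := by
    change TensorialAt.mkHom _ x (S.tensorialAt_transversal x) (Y x) X = _
    rw [TensorialAt.mkHom_apply (S.tensorialAt_transversal x) hY]
    rfl
  rw [h]
  exact (S.split_eq x (mvfderiv (𝓡 n) (S.pushField Y) x X)).symm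

/-- The hypersurface is centroaffine: `ξ` is a non-zero constant multiple of the position vector
with respect to some centre `c`. -/
def IsCentroaffine : Prop :=
  ∃ (c : EuclideanSpace ℝ (Fin (n + 1))) (a : ℝ), a ≠ 0 ∧ ∀ x, S.ξ x = a • (S.f x - c)

/-- The hypersurface is non-degenerate: its second fundamental form is non-degenerate. -/
def IsNondegenerate : Prop :=
  ∀ (x : M) (v : TangentSpace (𝓡 n) x),
    (∀ w : TangentSpace (𝓡 n) x, S.secondFundamentalForm x v w = 0) → v = 0

/-- A centroaffine ovaloid: a non-degenerate centroaffine hypersurface whose underlying manifold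
is diffeomorphic to the Euclidean sphere `Sⁿ`. -/
def IsCentroaffineOvaloid : Prop :=
  Nonempty (M ≃ₘ^∞⟮𝓡 n, 𝓡 n⟯ Metric.sphere (0 : EuclideanSpace ℝ (Fin (n + 1))) 1) ∧
    S.IsCentroaffine ∧ S.IsNondegenerate

end AffineHypersurface

end

/-! Put `σ = f ∘ γ - c`. Since `ξ` is a multiple of the position vector from `c`, `γ` is a geodesic
exactly when `σ''` is a multiple of `σ`: the curve stays in a plane through the center and sweeps
area at a constant rate, as in Kepler's second law. Given `x` and `v`, let `p = f x - c`, `w = f_*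
v`, and let `J` be the skew operator of `p` and `w`. On the plane of `p` and `w` it is a constant
multiple of a quarter turn, so `‖σ‖⁻² J σ` has constant moment about the center, and adding a
multiple of `σ` does not change that. The tangential part of this field is a smooth vector field on
`M` with value `v` at `x`, and its integral curve through `x` is the desired geodesic
(`exists_hasDerivAt_deriv_eq_smul`). Compactness of `M` makes the curve run for all time
(`exists_isMIntegralCurve_of_compactSpace`). For the dual connection, the conormal map is itself a
centroaffine immersion with center `0`, and its induced connection is dual to `∇`
(`isDualConnection_dual`). The same completeness theorem applies to it, and non-degeneracy of `g`
makes the dual connection unique. -/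

noncomputable section

/-! ### Integral curves of vector fields on compact manifolds -/

section IntegralCurves

open Set Topology

variable {E : Type*} [NormedAddCommGroup E] [NormedSpace ℝ E]
  {H : Type*} [TopologicalSpace H] {I : ModelWithCorners ℝ E H}
  {M : Type*} [TopologicalSpace M] [ChartedSpace H M] [IsManifold I 1 M]
  {v : (x : M) → TangentSpace I x}

/-- A solution of the coordinate expression of the differential equation in the chart at `x₀`
gives an integral curve on the manifold. -/
lemma hasMFDerivAt_extChartAt_symm_comp {x₀ : M} {u : ℝ → E} {t : ℝ}
    (hmem : u t ∈ interior (extChartAt I x₀).target)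
    (h : HasDerivAt u (tangentCoordChange I ((extChartAt I x₀).symm (u t)) x₀
      ((extChartAt I x₀).symm (u t)) (v ((extChartAt I x₀).symm (u t)))) t) :
    HasMFDerivAt 𝓘(ℝ, ℝ) I ((extChartAt I x₀).symm ∘ u) t
      ((1 : ℝ →L[ℝ] ℝ).smulRight (v (((extChartAt I x₀).symm ∘ u) t))) := by
  have hmem' := interior_subset hmem
  have hsrc := (extChartAt I x₀).map_target hmem'
  have hself := mem_extChartAt_source (I := I) ((extChartAt I x₀).symm (u t))
  -- The manifold derivative is read in the preferred chart at the current point, not in the chart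
  -- at `x₀`; the two coordinate changes of `v` cancel.
  suffices hd : HasDerivAt
      ((extChartAt I ((extChartAt I x₀).symm (u t)) ∘ (extChartAt I x₀).symm) ∘ u)
      (v ((extChartAt I x₀).symm (u t)) : E) t by
    refine ⟨(continuousAt_extChartAt_symm'' hmem').comp h.continuousAt, ?_⟩
    exact hd.hasFDerivAt.hasFDerivWithinAt
  have hv : v ((extChartAt I x₀).symm (u t)) =
      tangentCoordChange I x₀ ((extChartAt I x₀).symm (u t)) ((extChartAt I x₀).symm (u t))
        (tangentCoordChange I ((extChartAt I x₀).symm (u t)) x₀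
      ((extChartAt I x₀).symm (u t)) (v ((extChartAt I x₀).symm (u t)))) := by
    refine Eq.trans ?_ (tangentCoordChange_comp (x := x₀) ⟨⟨hself, hsrc⟩, hself⟩).symm
    exact (tangentCoordChange_self hself).symm
  rw [hv]
  refine HasFDerivAt.comp_hasDerivAt _ ?_ h
  refine HasFDerivWithinAt.hasFDerivAt (s := range I) ?_ <|
    mem_nhds_iff.mpr ⟨interior (extChartAt I x₀).target,
      subset_trans interior_subset (extChartAt_target_subset_range ..), isOpen_interior, hmem⟩
  have := hasFDerivWithinAt_tangentCoordChange (I := I) ⟨hsrc, hself⟩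
  rwa [(extChartAt I x₀).right_inv hmem'] at this

/-- Integral curves of a `C¹` vector field exist for a uniform time near every point. -/
theorem exists_nhds_forall_exists_isMIntegralCurveOn [CompleteSpace E] [BoundarylessManifold I M]
    {x₀ : M} (hv : CMDiffAt 1 (fun x ↦ (⟨x, v x⟩ : TangentBundle I M)) x₀) :
    ∃ U ∈ 𝓝 x₀, ∃ ε > (0 : ℝ), ∀ x ∈ U, ∃ γ : ℝ → M,
      γ 0 = x ∧ IsMIntegralCurveOn γ v (Ioo (-ε) ε) := by
  have hx : I.IsInteriorPoint x₀ := BoundarylessManifold.isInteriorPoint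
  rw [contMDiffAt_iff] at hv
  have hv' := (hv.2.contDiffAt (range_mem_nhds_isInteriorPoint hx)).snd
  obtain ⟨ε, hε, a, r, L, K, hr, hpl⟩ := IsPicardLindelof.of_contDiffAt_one hv'
  obtain ⟨α, hα, hcont⟩ :=
    (hpl 0).exists_forall_mem_closedBall_eq_hasDerivWithinAt_continuousOn
  have hr' : (0 : ℝ) < r := hr
  have hnhds : Metric.closedBall (extChartAt I x₀ x₀) (r : ℝ) ×ˢ Icc (0 - ε) (0 + ε) ∈
      𝓝 (extChartAt I x₀ x₀, (0 : ℝ)) :=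
    prod_mem_nhds (Metric.closedBall_mem_nhds _ hr') (Icc_mem_nhds (by linarith) (by linarith))
  have hc : ContinuousAt α (extChartAt I x₀ x₀, 0) := hcont.continuousAt hnhds
  have h0 : α (extChartAt I x₀ x₀, 0) = extChartAt I x₀ x₀ :=
    (hα _ (Metric.mem_closedBall_self hr'.le)).1
  -- Joint continuity of the local flow keeps all nearby solutions inside the chart for one common
  -- time.
  have htgt : α ⁻¹' interior (extChartAt I x₀).target ∈ 𝓝 (extChartAt I x₀ x₀, (0 : ℝ)) := by
    refine hc.preimage_mem_nhds (isOpen_interior.mem_nhds ?_)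
    rw [h0]
    exact I.isInteriorPoint_iff.mp hx
  obtain ⟨A, hA, B, hB, hAB⟩ := mem_nhds_prod_iff.mp (Filter.inter_mem hnhds htgt)
  obtain ⟨δ, hδ, hδB⟩ := Metric.mem_nhds_iff.mp hB
  refine ⟨(extChartAt I x₀).source ∩ extChartAt I x₀ ⁻¹' A, Filter.inter_mem
    (extChartAt_source_mem_nhds x₀) ((continuousAt_extChartAt x₀).preimage_mem_nhds hA),
    min δ ε, lt_min hδ hε, fun x hxU ↦ ?_⟩
  have hball : extChartAt I x₀ x ∈ Metric.closedBall (extChartAt I x₀ x₀) (r : ℝ) :=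
    (hAB (⟨hxU.2, mem_of_mem_nhds hB⟩ : (extChartAt I x₀ x, (0 : ℝ)) ∈ A ×ˢ B)).1.1
  refine ⟨(extChartAt I x₀).symm ∘ fun t ↦ α (extChartAt I x₀ x, t), ?_, fun t ht ↦ ?_⟩
  · change (extChartAt I x₀).symm (α (extChartAt I x₀ x, 0)) = x
    rw [(hα _ hball).1, (extChartAt I x₀).left_inv hxU.1]
  · have htB : t ∈ B := hδB (by
      rw [Real.ball_eq_Ioo]
      have := min_le_left δ ε
      exact ⟨by linarith [ht.1], by linarith [ht.2]⟩)
    have hmem := (hAB (⟨hxU.2, htB⟩ : (extChartAt I x₀ x, t) ∈ A ×ˢ B)).2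
    have htε : t ∈ Ioo (0 - ε) (0 + ε) := by
      have := min_le_right δ ε
      exact ⟨by linarith [ht.1], by linarith [ht.2]⟩
    have hd := ((hα _ hball).2 t (Ioo_subset_Icc_self htε)).hasDerivAt
      (Icc_mem_nhds htε.1 htε.2)
    exact (hasMFDerivAt_extChartAt_symm_comp hmem hd).hasMFDerivWithinAt

/-- A `C¹` vector field on a compact manifold is complete. -/
theorem exists_isMIntegralCurve_of_compactSpace [CompleteSpace E] [BoundarylessManifold I M]
    [T2Space M] [CompactSpace M]
    (hv : CMDiff 1 (fun x ↦ (⟨x, v x⟩ : TangentBundle I M))) (x : M) :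
    ∃ γ : ℝ → M, γ 0 = x ∧ IsMIntegralCurve γ v := by
  choose U hU ε hε hγ using fun x ↦ exists_nhds_forall_exists_isMIntegralCurveOn (hv x)
  obtain ⟨s, hs⟩ := finite_cover_nhds hU
  have hne : s.Nonempty := by
    obtain ⟨y, hy, -⟩ := mem_iUnion₂.mp (hs ▸ mem_univ x)
    exact ⟨y, hy⟩
  -- The least of the finitely many existence times serves at every point, and a uniform time
  -- extends to the whole line.
  refine exists_isMIntegralCurve_of_isMIntegralCurveOn hv
    (ε := s.inf' hne ε) ((Finset.lt_inf'_iff hne).2 fun y _ ↦ hε y) (fun z ↦ ?_) x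
  obtain ⟨y, hy, hzy⟩ := mem_iUnion₂.mp (hs ▸ mem_univ z)
  obtain ⟨γ, h0, h⟩ := hγ y z hzy
  have hle := Finset.inf'_le ε hy
  exact ⟨γ, h0, h.mono (Ioo_subset_Ioo (neg_le_neg hle) hle)⟩

/-- Integral curves of smooth vector fields are smooth. -/
theorem IsMIntegralCurve.contMDiff {γ : ℝ → M} (hγ : IsMIntegralCurve γ v)
    (hv : CMDiff ∞ (fun x ↦ (⟨x, v x⟩ : TangentBundle I M))) :
    ContMDiff 𝓘(ℝ, ℝ) I ∞ γ := by
  refine contMDiff_infty.2 fun k ↦ ?_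
  -- Bootstrap: if `γ` is `C^k`, so is `γ' = v ∘ γ`, hence `γ` is `C^(k+1)`.
  induction k with
  | zero => exact contMDiff_zero_iff.2 hγ.continuous
  | succ k ih =>
    intro t₀
    have hcomp : ContMDiffAt 𝓘(ℝ, ℝ) I.tangent k
        (fun t ↦ (⟨γ t, v (γ t)⟩ : TangentBundle I M)) t₀ :=
      ((hv.of_le (by exact_mod_cast le_top)).comp ih) t₀
    have hw := ((contMDiffAt_totalSpace (n := (k : WithTop ℕ∞))).1 hcomp).2.contDiffAt
    have hd := (hγ.isMIntegralCurveAt t₀).eventually_hasDerivAt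
    refine contMDiffAt_iff_target.2 ⟨hγ.continuous.continuousAt, ?_⟩
    rw [contMDiffAt_iff_contDiffAt]
    push_cast
    rw [contDiffAt_succ_iff_hasFDerivAt]
    obtain ⟨s, hs, hds⟩ := hd.exists_mem
    refine ⟨fun t ↦ ContinuousLinearMap.toSpanSingleton ℝ
      ((trivializationAt E (TangentSpace I) (γ t₀)) ⟨γ t, v (γ t)⟩).2,
      ⟨s, hs, fun t ht ↦ (hds t ht).hasFDerivAt⟩, ?_⟩
    exact (ContinuousLinearMap.toSpanSingletonCLE (𝕜 := ℝ) (E := E)).contDiff.contDiffAt.comp t₀ hw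

end IntegralCurves

/-! ### Smoothness of the tangential and transversal components. -/

namespace AffineHypersurface

variable {n : ℕ} {M : Type*} [TopologicalSpace M] [ChartedSpace (EuclideanSpace ℝ (Fin n)) M]
  [IsManifold (𝓡 n) ∞ M] (S : AffineHypersurface n M)

/-- The differential of the immersion, read in the trivialization of the tangent bundle given by
the chart at `x₀`. -/
def pushCoord (x₀ y : M) : EuclideanSpace ℝ (Fin n) →L[ℝ] EuclideanSpace ℝ (Fin (n + 1)) :=
  S.push y ∘L (trivializationAt (EuclideanSpace ℝ (Fin n)) (TangentSpace (𝓡 n)) x₀).symmL ℝ y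

/-- The splitting `(v, a) ↦ f_* v + a ξ`, read in the trivialization of the tangent bundle given by
the chart at `x₀`. -/
def splitCoord (x₀ y : M) : (EuclideanSpace ℝ (Fin n) × ℝ) →L[ℝ] EuclideanSpace ℝ (Fin (n + 1)) :=
  (S.pushCoord x₀ y).coprod (ContinuousLinearMap.toSpanSingleton ℝ (S.ξ y))

lemma contMDiffAt_pushCoord (x₀ : M) :
    ContMDiffAt (𝓡 n) 𝓘(ℝ, EuclideanSpace ℝ (Fin n) →L[ℝ] EuclideanSpace ℝ (Fin (n + 1))) ∞
      (S.pushCoord x₀) x₀ := by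
  refine ((S.smooth_f x₀).mfderiv_const (m := ∞) (by norm_cast)).congr_of_eventuallyEq
    (Filter.Eventually.of_forall fun y ↦ ?_)
  simp only [inTangentCoordinates, ContinuousLinearMap.inCoordinates]
  rw [TangentBundle.continuousLinearMapAt_model_space]
  rfl

lemma contMDiffAt_splitCoord (x₀ : M) :
    ContMDiffAt (𝓡 n)
      𝓘(ℝ, (EuclideanSpace ℝ (Fin n) × ℝ) →L[ℝ] EuclideanSpace ℝ (Fin (n + 1))) ∞
      (S.splitCoord x₀) x₀ := by
  have h : S.splitCoord x₀ = fun y ↦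
      S.pushCoord x₀ y ∘L ContinuousLinearMap.fst ℝ (EuclideanSpace ℝ (Fin n)) ℝ +
        ContinuousLinearMap.toSpanSingletonCLE (𝕜 := ℝ) (S.ξ y) ∘L
          ContinuousLinearMap.snd ℝ (EuclideanSpace ℝ (Fin n)) ℝ := by
    ext1 y
    refine ContinuousLinearMap.ext fun z ↦ ?_
    simp [splitCoord]
  rw [h]
  refine ContMDiffAt.add ((S.contMDiffAt_pushCoord x₀).clm_comp contMDiffAt_const)
    (ContMDiffAt.clm_comp ?_ contMDiffAt_const)
  exact (ContinuousLinearMap.toSpanSingletonCLE (𝕜 := ℝ)).contDiff.contDiffAt.comp_contMDiffAt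
    (S.smooth_ξ x₀)

lemma splitCoord_apply_split {x₀ y : M} (hy : y ∈ (chartAt (EuclideanSpace ℝ (Fin n)) x₀).source)
    (w : EuclideanSpace ℝ (Fin (n + 1))) :
    S.splitCoord x₀ y ((trivializationAt (EuclideanSpace ℝ (Fin n)) (TangentSpace (𝓡 n)) x₀
      ⟨y, S.tangentPart y w⟩).2, S.transversalPart y w) = w := by
  conv_rhs => rw [← S.split_eq y w]
  simp only [splitCoord, pushCoord, ContinuousLinearMap.coprod_apply,
    ContinuousLinearMap.comp_apply, ContinuousLinearMap.toSpanSingleton_apply]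
  congr 2
  rw [Trivialization.symmL_apply _ (show y ∈ (trivializationAt (EuclideanSpace ℝ (Fin n))
    (TangentSpace (𝓡 n)) x₀).baseSet from hy)]
  exact (trivializationAt (EuclideanSpace ℝ (Fin n)) (TangentSpace (𝓡 n)) x₀).symm_proj_apply
    ⟨y, S.tangentPart y w⟩ hy

lemma isInvertible_splitCoord {x₀ y : M}
    (hy : y ∈ (chartAt (EuclideanSpace ℝ (Fin n)) x₀).source) :
    (S.splitCoord x₀ y).IsInvertible := by
  have hsurj : Function.Surjective (S.splitCoord x₀ y).toLinearMap :=
    fun w ↦ ⟨_, S.splitCoord_apply_split hy w⟩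
  have hinj := (LinearMap.injective_iff_surjective_of_finrank_eq_finrank (by simp)).2 hsurj
  exact ⟨(LinearEquiv.ofBijective _ ⟨hinj, hsurj⟩).toContinuousLinearEquiv, rfl⟩

lemma inverse_splitCoord_apply {x₀ y : M}
    (hy : y ∈ (chartAt (EuclideanSpace ℝ (Fin n)) x₀).source)
    (w : EuclideanSpace ℝ (Fin (n + 1))) :
    (S.splitCoord x₀ y).inverse w =
      ((trivializationAt (EuclideanSpace ℝ (Fin n)) (TangentSpace (𝓡 n)) x₀
        ⟨y, S.tangentPart y w⟩).2, S.transversalPart y w) := by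
  conv_lhs => rw [← S.splitCoord_apply_split hy w]
  obtain ⟨e, he⟩ := S.isInvertible_splitCoord hy
  rw [← he, ContinuousLinearMap.inverse_equiv]
  exact e.symm_apply_apply _

lemma contMDiffAt_inverse_splitCoord (x₀ : M) :
    ContMDiffAt (𝓡 n)
      𝓘(ℝ, EuclideanSpace ℝ (Fin (n + 1)) →L[ℝ] (EuclideanSpace ℝ (Fin n) × ℝ)) ∞
      (fun y ↦ (S.splitCoord x₀ y).inverse) x₀ := by
  obtain ⟨e, he⟩ := S.isInvertible_splitCoord (mem_chart_source (EuclideanSpace ℝ (Fin n)) x₀)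
  have h := contDiffAt_map_inverse (n := ∞) e
  rw [he] at h
  exact h.comp_contMDiffAt (S.contMDiffAt_splitCoord x₀)

/-- The conormal field, that is, the transversal component, is smooth. -/
lemma contMDiff_transversalPart :
    ContMDiff (𝓡 n) 𝓘(ℝ, EuclideanSpace ℝ (Fin (n + 1)) →L[ℝ] ℝ) ∞ S.transversalPart := by
  intro x₀
  have h : ContMDiffAt (𝓡 n) 𝓘(ℝ, EuclideanSpace ℝ (Fin (n + 1)) →L[ℝ] ℝ) ∞
      (fun y ↦ ContinuousLinearMap.snd ℝ (EuclideanSpace ℝ (Fin n)) ℝ ∘L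
        (S.splitCoord x₀ y).inverse) x₀ :=
    contMDiffAt_const.clm_comp (S.contMDiffAt_inverse_splitCoord x₀)
  refine h.congr_of_eventuallyEq ?_
  filter_upwards [chart_source_mem_nhds (EuclideanSpace ℝ (Fin n)) x₀] with y hy
  ext1 w
  simp [S.inverse_splitCoord_apply hy w]

/-- The tangential component of a smooth field is a smooth vector field. -/
lemma contMDiff_tangentPart {w : M → EuclideanSpace ℝ (Fin (n + 1))}
    (hw : ContMDiff (𝓡 n) 𝓘(ℝ, EuclideanSpace ℝ (Fin (n + 1))) ∞ w) :
    ContMDiff (𝓡 n) (𝓡 n).tangent ∞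
      (fun y ↦ (⟨y, S.tangentPart y (w y)⟩ : TangentBundle (𝓡 n) M)) := by
  intro x₀
  refine contMDiffAt_totalSpace.2 ⟨contMDiffAt_id, ?_⟩
  have h : ContMDiffAt (𝓡 n) 𝓘(ℝ, EuclideanSpace ℝ (Fin n)) ∞
      (fun y ↦ ((S.splitCoord x₀ y).inverse (w y)).1) x₀ :=
    (contDiff_fst (𝕜 := ℝ)).contDiffAt.comp_contMDiffAt
      ((S.contMDiffAt_inverse_splitCoord x₀).clm_apply (hw x₀))
  refine h.congr_of_eventuallyEq ?_
  filter_upwards [chart_source_mem_nhds (EuclideanSpace ℝ (Fin n)) x₀] with y hy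
  rw [S.inverse_splitCoord_apply hy]

end AffineHypersurface

/-! ### Chain and product rules for vector-valued functions on a manifold. -/

section Calculus

variable {E : Type*} [NormedAddCommGroup E] [NormedSpace ℝ E]
  {H : Type*} [TopologicalSpace H] {I : ModelWithCorners ℝ E H}
  {M : Type*} [TopologicalSpace M] [ChartedSpace H M]
  {F G K : Type*} [NormedAddCommGroup F] [NormedSpace ℝ F] [NormedAddCommGroup G] [NormedSpace ℝ G]
  [NormedAddCommGroup K] [NormedSpace ℝ K]

lemma hasDerivAt_comp_curve {g : M → F} {γ : ℝ → M} {t : ℝ}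
    (hg : MDifferentiableAt I 𝓘(ℝ, F) g (γ t)) (hγ : MDifferentiableAt 𝓘(ℝ, ℝ) I γ t) :
    HasDerivAt (fun s ↦ g (γ s)) (mvfderiv I g (γ t) (curveVelocity I γ t)) t := by
  have h : HasFDerivAt (fun s ↦ g (γ s))
      ((mvfderiv I g (γ t) ∘L mfderiv 𝓘(ℝ, ℝ) I γ t : ℝ →L[ℝ] F)) t :=
    (hg.hasMFDerivAt.comp t hγ.hasMFDerivAt).hasFDerivAt
  exact h.hasDerivAt

lemma mvfderiv_comp_of_hasFDerivAt {Φ : F → G} {Φ' : F →L[ℝ] G} {g : M → F} {x : M}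
    (hΦ : HasFDerivAt Φ Φ' (g x)) (hg : MDifferentiableAt I 𝓘(ℝ, F) g x) (X : TangentSpace I x) :
    mvfderiv I (fun y ↦ Φ (g y)) x X = Φ' (mvfderiv I g x X) := by
  have h := (hΦ.hasMFDerivAt.comp x hg.hasMFDerivAt).mfderiv
  change mfderiv I 𝓘(ℝ, G) (Φ ∘ g) x X = _
  rw [h]
  rfl

lemma mvfderiv_bilinear (B : F →L[ℝ] G →L[ℝ] K) {a : M → F} {b : M → G} {x : M}
    (ha : MDifferentiableAt I 𝓘(ℝ, F) a x) (hb : MDifferentiableAt I 𝓘(ℝ, G) b x)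
    (X : TangentSpace I x) :
    mvfderiv I (fun y ↦ B (a y) (b y)) x X =
      B (mvfderiv I a x X) (b x) + B (a x) (mvfderiv I b x X) := by
  have hab := ha.prodMk_space hb
  have h := mvfderiv_comp_of_hasFDerivAt (g := fun y ↦ (a y, b y)) (B.hasFDerivAt_of_bilinear
    (hasFDerivAt_fst (𝕜 := ℝ) (p := (a x, b x))) hasFDerivAt_snd) hab X
  have h1 := mvfderiv_comp_of_hasFDerivAt (g := fun y ↦ (a y, b y))
    (hasFDerivAt_fst (𝕜 := ℝ) (p := (a x, b x))) hab X
  have h2 := mvfderiv_comp_of_hasFDerivAt (g := fun y ↦ (a y, b y))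
    (hasFDerivAt_snd (𝕜 := ℝ) (p := (a x, b x))) hab X
  refine h.trans ?_
  simp only [ContinuousLinearMap.coe_fst', ContinuousLinearMap.coe_snd'] at h1 h2
  simp [h1, h2, add_comm]

lemma mvfderiv_inner {F : Type*} [NormedAddCommGroup F] [InnerProductSpace ℝ F] {a b : M → F}
    {x : M} (ha : MDifferentiableAt I 𝓘(ℝ, F) a x) (hb : MDifferentiableAt I 𝓘(ℝ, F) b x)
    (X : TangentSpace I x) :
    mvfderiv I (fun y ↦ inner ℝ (a y) (b y)) x X =
      inner ℝ (mvfderiv I a x X) (b x) + inner ℝ (a x) (mvfderiv I b x X) :=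
  mvfderiv_bilinear (innerSL ℝ) ha hb X

end Calculus

/-! ### Covariant differentiation along curves in the ambient space. -/

namespace AffineHypersurface

variable {n : ℕ} {M : Type*} [TopologicalSpace M] [ChartedSpace (EuclideanSpace ℝ (Fin n)) M]
  [IsManifold (𝓡 n) ∞ M] (S : AffineHypersurface n M)

/-- The covariant derivative along a curve, with respect to the induced connection, is the
tangential component of the ordinary derivative in the ambient space. -/
lemma covDerivAlong_inducedConnection {γ : ℝ → M} {V : ∀ t, TangentSpace (𝓡 n) (γ t)} {t : ℝ}
    (hγ : MDifferentiableAt 𝓘(ℝ, ℝ) (𝓡 n) γ t)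
    (hV : DifferentiableAt ℝ (fun s ↦ (trivializationAt (EuclideanSpace ℝ (Fin n))
      (TangentSpace (𝓡 n) : M → Type _) (γ t) ⟨γ s, V s⟩).2) t) :
    covDerivAlong S.inducedConnection γ V t =
      S.tangentPart (γ t) (deriv (fun s ↦ S.push (γ s) (V s)) t) := by
  set e := trivializationAt (EuclideanSpace ℝ (Fin n)) (TangentSpace (𝓡 n) : M → Type _) (γ t)
  have hbase : e.baseSet ∈ nhds (γ t) := chart_source_mem_nhds (EuclideanSpace ℝ (Fin n)) (γ t)
  have hA : MDifferentiableAt (𝓡 n) _ (S.pushCoord (γ t)) (γ t) :=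
    (S.contMDiffAt_pushCoord (γ t)).mdifferentiableAt (by simp)
  have hderiv := (hasDerivAt_comp_curve hA hγ).clm_apply hV.hasDerivAt
  have heq : (fun s ↦ S.push (γ s) (V s)) =ᶠ[nhds t]
      fun s ↦ S.pushCoord (γ t) (γ s) (e ⟨γ s, V s⟩).2 := by
    filter_upwards [hγ.continuousAt.preimage_mem_nhds hbase] with s hs
    simp only [pushCoord, ContinuousLinearMap.comp_apply]
    congr 1
    rw [Trivialization.symmL_apply _ hs]
    exact (e.symm_proj_apply ⟨γ s, V s⟩ hs).symm
  -- Product rule for `f_* V = A(γ) v`: the term `A v'` gives the coordinate derivative, and `(A ∘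
  -- γ)' v` gives the connection applied to the field with constant coordinates.
  rw [heq.deriv_eq, hderiv.deriv, map_add, add_comm]
  simp only [covDerivAlong]
  congr 1
  · simp only [pushCoord, ContinuousLinearMap.comp_apply, tangentPart_push]
    exact (Trivialization.symmL_apply _ (mem_of_mem_nhds hbase) _).symm
  · change S.tangentPart (γ t) (mvfderiv (𝓡 n) (S.pushField _) (γ t) _) = _
    congr 1
    have heq' : S.pushField (FiberBundle.extend (EuclideanSpace ℝ (Fin n)) (V t)) =ᶠ[nhds (γ t)]
        fun y ↦ S.pushCoord (γ t) y (e ⟨γ t, V t⟩).2 := by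
      filter_upwards [hbase] with y hy
      simp only [pushCoord, pushField, ContinuousLinearMap.comp_apply]
      congr 1
      exact (Trivialization.symmL_apply _ hy _).symm
    have h1 := mvfderiv_comp_of_hasFDerivAt (ContinuousLinearMap.hasFDerivAt
      (ContinuousLinearMap.apply ℝ (EuclideanSpace ℝ (Fin (n + 1))) (e ⟨γ t, V t⟩).2))
      hA (curveVelocity (𝓡 n) γ t)
    refine Eq.trans ?_ h1
    simp only [mvfderiv]
    rw [heq'.mfderiv_eq]
    rfl

end AffineHypersurface

/-! ### Curves with acceleration directed to the origin. -/

section PlaneCurves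

variable {F : Type*} [NormedAddCommGroup F]

/-- The integrating factor `exp (-∫ l)` turns `y` into a constant. -/
lemma eq_zero_of_hasDerivAt_smul_self [NormedSpace ℝ F] {y : ℝ → F} {l : ℝ → ℝ} (hl : Continuous l)
    (hy : ∀ t, HasDerivAt y (l t • y t) t) (h0 : y 0 = 0) (t : ℝ) : y t = 0 := by
  have hL (t : ℝ) : HasDerivAt (fun t ↦ ∫ s in (0 : ℝ)..t, l s) (l t) t :=
    intervalIntegral.integral_hasDerivAt_right (hl.intervalIntegrable _ _)
      (hl.stronglyMeasurableAtFilter _ _) hl.continuousAt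
  have hz (t : ℝ) : HasDerivAt (fun t ↦ Real.exp (-∫ s in (0 : ℝ)..t, l s) • y t) 0 t := by
    have h := ((hL t).neg.exp).smul (hy t)
    refine h.congr_deriv ?_
    module
  have hconst := is_const_of_deriv_eq_zero (fun t ↦ (hz t).differentiableAt)
    (fun t ↦ (hz t).deriv) t 0
  simpa [h0, Real.exp_ne_zero] using hconst

variable [InnerProductSpace ℝ F]

/-- A curve `σ` solving `σ' = ‖σ‖⁻² J σ + l σ`, with `J` skew-symmetric of rank at most two and
`σ 0` in the plane of `J`, has acceleration pointing to the origin. -/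
lemma exists_hasDerivAt_deriv_eq_smul {J : F →L[ℝ] F} {D : ℝ} (hskew : ∀ z, inner ℝ z (J z) = 0)
    (hJ : ∀ z, J (J (J z)) = -D • J z) {σ : ℝ → F} {l : ℝ → ℝ} (hl : Differentiable ℝ l)
    (hne : ∀ t, σ t ≠ 0)
    (hσ : ∀ t, HasDerivAt σ ((‖σ t‖ ^ 2)⁻¹ • J (σ t) + l t • σ t) t)
    (h0 : J (J (σ 0)) = -D • σ 0) (t : ℝ) :
    ∃ μ : ℝ, HasDerivAt (deriv σ) (μ • σ t) t := by
  have hplane (t : ℝ) : J (J (σ t)) + D • σ t = 0 := by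
    -- Because `J³ + D J = 0`, the `J σ` term of `σ'` contributes nothing, so `y' = l y`: the curve
    -- never leaves the kernel of `J² + D`.
    refine eq_zero_of_hasDerivAt_smul_self (y := fun t ↦ J (J (σ t)) + D • σ t) hl.continuous
      (fun t ↦ ?_) (by simp [h0]) t
    have h := ((J.hasFDerivAt.comp_hasDerivAt t (J.hasFDerivAt.comp_hasDerivAt t (hσ t)))).add
      ((hσ t).const_smul D)
    refine h.congr_deriv ?_
    simp only [map_add, map_smul, hJ]
    module
  have hd : deriv σ = fun t ↦ (‖σ t‖ ^ 2)⁻¹ • J (σ t) + l t • σ t :=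
    funext fun t ↦ (hσ t).deriv
  rw [hd]
  have hn : ‖σ t‖ ^ 2 ≠ 0 := pow_ne_zero _ (norm_ne_zero_iff.2 (hne t))
  have hsq := (hσ t).norm_sq
  have h := ((hsq.inv hn).smul (J.hasFDerivAt.comp_hasDerivAt t (hσ t))).add
    ((hl t).hasDerivAt.smul (hσ t))
  -- Skewness gives `(‖σ‖²)' = 2 l ‖σ‖²`, so the coefficients of `‖σ‖⁻² J σ` in `σ''` are `-2l + l +
  -- l = 0`; the rest is a multiple of `σ` since `J² σ = -D σ`.
  refine ⟨-D * ((‖σ t‖ ^ 2)⁻¹) ^ 2 + deriv l t + l t ^ 2, h.congr_deriv ?_⟩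
  have hJJ : J (J (σ t)) = -D • σ t := by
    rw [neg_smul]; exact eq_neg_of_add_eq_zero_left (hplane t)
  simp only [inner_add_right, inner_smul_right, hskew, map_add, map_smul, hJJ,
    real_inner_self_eq_norm_sq, Function.comp_apply, Pi.inv_apply]
  match_scalars <;> field_simp <;> ring

/-- The skew-symmetric operator `z ↦ ⟨p, z⟩ w - ⟨w, z⟩ p`. -/
def skewOperator (p w : F) : F →L[ℝ] F :=
  (innerSL ℝ p).smulRight w - (innerSL ℝ w).smulRight p

lemma skewOperator_apply (p w z : F) :
    skewOperator p w z = inner ℝ p z • w - inner ℝ w z • p := by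
  simp [skewOperator]

lemma inner_skewOperator_self (p w z : F) : inner ℝ z (skewOperator p w z) = 0 := by
  rw [skewOperator_apply, inner_sub_right, inner_smul_right, inner_smul_right,
    real_inner_comm p, real_inner_comm w]
  ring

/-- The scalar is the Gram determinant of `p` and `w`, the constant `D` of the plane-curve lemma. -/
lemma skewOperator_skewOperator_left (p w : F) :
    skewOperator p w (skewOperator p w p) =
      -(inner ℝ p p * inner ℝ w w - inner ℝ p w ^ 2) • p := by
  simp only [skewOperator_apply, inner_sub_right, inner_smul_right, real_inner_comm p w]
  module

lemma skewOperator_cube (p w z : F) :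
    skewOperator p w (skewOperator p w (skewOperator p w z)) =
      -(inner ℝ p p * inner ℝ w w - inner ℝ p w ^ 2) • skewOperator p w z := by
  simp only [skewOperator_apply, inner_sub_right, inner_smul_right, real_inner_comm p w]
  module

end PlaneCurves

/-! ### Geodesic completeness of compact centroaffine hypersurfaces. -/

namespace AffineHypersurface

variable {n : ℕ} {M : Type*} [TopologicalSpace M] [ChartedSpace (EuclideanSpace ℝ (Fin n)) M]

section

variable (S : AffineHypersurface n M)

lemma split_symm_ξ (x : M) : (S.split x).symm (S.ξ x) = (0, 1) := by
  rw [LinearEquiv.symm_apply_eq]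
  exact (by simp [splitMap_apply] : S.ξ x = S.splitMap x (0, 1))

@[simp] lemma tangentPart_ξ (x : M) : S.tangentPart x (S.ξ x) = 0 :=
  congrArg Prod.fst (S.split_symm_ξ x)

@[simp] lemma transversalPart_ξ (x : M) : S.transversalPart x (S.ξ x) = 1 :=
  congrArg Prod.snd (S.split_symm_ξ x)

lemma ξ_ne_zero (x : M) : S.ξ x ≠ 0 := fun h ↦ S.transversal x ⟨0, by simp [h]⟩

end

variable [IsManifold (𝓡 n) ∞ M] (S : AffineHypersurface n M)

/-- The induced connection of a compact centroaffine hypersurface is geodesically complete. -/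
theorem isGeodesicallyComplete_inducedConnection [CompactSpace M] [T2Space M]
    (hS : S.IsCentroaffine) : IsGeodesicallyComplete S.inducedConnection := by
  obtain ⟨c, a, ha, hξ⟩ := hS
  intro x v
  have hne (y : M) : S.f y - c ≠ 0 := fun h ↦ S.ξ_ne_zero y (by rw [hξ, h, smul_zero])
  have htan (y : M) : S.tangentPart y (S.f y - c) = 0 := by
    have h := S.tangentPart_ξ y
    rw [hξ, map_smul] at h
    exact (smul_eq_zero.1 h).resolve_left ha
  set J := skewOperator (S.f x - c) (S.push x v) with hJ
  set W : M → EuclideanSpace ℝ (Fin (n + 1)) :=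
    fun y ↦ (‖S.f y - c‖ ^ 2)⁻¹ • J (S.f y - c) with hW
  have hfc : ContMDiff (𝓡 n) 𝓘(ℝ, EuclideanSpace ℝ (Fin (n + 1))) ∞ (fun y ↦ S.f y - c) :=
    S.smooth_f.sub contMDiff_const
  have hWs : ContMDiff (𝓡 n) 𝓘(ℝ, EuclideanSpace ℝ (Fin (n + 1))) ∞ W := by
    intro y
    have h : ContDiffAt ℝ ∞ (fun z : EuclideanSpace ℝ (Fin (n + 1)) ↦ (‖z‖ ^ 2)⁻¹ • J z)
        (S.f y - c) :=
      (((contDiff_norm_sq ℝ).contDiffAt).inv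
        (pow_ne_zero _ (norm_ne_zero_iff.2 (hne y)))).smul J.contDiff.contDiffAt
    exact h.comp_contMDiffAt (f := fun y ↦ S.f y - c) (hfc y)
  set X : ∀ y : M, TangentSpace (𝓡 n) y := fun y ↦ S.tangentPart y (W y) with hX
  have hXs : ContMDiff (𝓡 n) (𝓡 n).tangent ∞ (fun y ↦ (⟨y, X y⟩ : TangentBundle (𝓡 n) M)) :=
    S.contMDiff_tangentPart hWs
  -- `J p = ‖p‖² w - ⟨w, p⟩ p` for `p = f x - c`, and the tangential projection kills `p`; the
  -- factor `‖p‖⁻²` normalizes the velocity.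
  have hXx : X x = v := by
    have hn : ‖S.f x - c‖ ^ 2 ≠ 0 := pow_ne_zero _ (norm_ne_zero_iff.2 (hne x))
    change S.tangentPart x ((‖S.f x - c‖ ^ 2)⁻¹ • J (S.f x - c)) = v
    rw [hJ, skewOperator_apply, map_smul, map_sub, map_smul, map_smul, htan, tangentPart_push,
      real_inner_self_eq_norm_sq, smul_zero, sub_zero, smul_smul, inv_mul_cancel₀ hn, one_smul]
  obtain ⟨γ, hγ0, hγ⟩ :=
    exists_isMIntegralCurve_of_compactSpace (hXs.of_le (by norm_cast)) x
  have hγs := hγ.contMDiff hXs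
  have hγd (t : ℝ) : MDifferentiableAt 𝓘(ℝ, ℝ) (𝓡 n) γ t := (hγs t).mdifferentiableAt (by simp)
  have hvel (t : ℝ) : curveVelocity (𝓡 n) γ t = X (γ t) := by
    rw [curveVelocity, (hγ t).mfderiv]
    exact one_smul ℝ (X (γ t))
  have hvel' : curveVelocity (𝓡 n) γ = fun t ↦ X (γ t) := funext hvel
  have hpush (t : ℝ) : HasDerivAt (fun s ↦ S.f (γ s) - c) (S.push (γ t) (X (γ t))) t := by
    have h := hasDerivAt_comp_curve (S.smooth_f.mdifferentiable (by simp) (γ t)) (hγd t)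
    rw [hvel] at h
    exact h.sub_const c
  have hderiv : deriv (fun s ↦ S.f (γ s) - c) = fun s ↦ S.push (γ s) (X (γ s)) :=
    funext fun s ↦ (hpush s).deriv
  refine ⟨γ, ⟨hγs, fun t ↦ ?_⟩, ?_⟩
  · have hV : DifferentiableAt ℝ (fun s ↦ (trivializationAt (EuclideanSpace ℝ (Fin n))
        (TangentSpace (𝓡 n) : M → Type _) (γ t) ⟨γ s, X (γ s)⟩).2) t :=
      ((contMDiffAt_totalSpace.1 ((hXs.comp hγs) t)).2.contDiffAt).differentiableAt (by simp)
    rw [hvel', S.covDerivAlong_inducedConnection (hγd t) hV, ← hderiv]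
    -- Removing the transversal part of `W` subtracts a multiple of `ξ = a σ`; this is the
    -- coefficient `l` of `σ`.
    have hl : Differentiable ℝ (fun s ↦ -(S.transversalPart (γ s) (W (γ s)) * a)) := by
      have h := (S.contMDiff_transversalPart.clm_apply hWs).comp hγs
      exact ((h.contDiff.differentiable (by simp)).mul_const a).neg
    have hσ (s : ℝ) : HasDerivAt (fun s ↦ S.f (γ s) - c) ((‖S.f (γ s) - c‖ ^ 2)⁻¹ •
        J (S.f (γ s) - c) + -(S.transversalPart (γ s) (W (γ s)) * a) • (S.f (γ s) - c)) s := by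
      refine (hpush s).congr_deriv ?_
      have h := S.split_eq (γ s) (W (γ s))
      rw [hξ, smul_smul] at h
      rw [neg_smul, ← sub_eq_add_neg]
      exact eq_sub_of_add_eq h
    obtain ⟨μ, hμ⟩ := exists_hasDerivAt_deriv_eq_smul (J := J) (inner_skewOperator_self _ _)
      (skewOperator_cube _ _) hl (fun s ↦ hne (γ s)) hσ
      (by simp only [hγ0]; exact skewOperator_skewOperator_left _ _) t
    rw [hμ.deriv, map_smul, htan, smul_zero]
  · rw [hvel]
    have h : (fun y ↦ (⟨y, X y⟩ : TangentBundle (𝓡 n) M)) (γ 0) = ⟨x, X x⟩ := by rw [hγ0]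
    rw [hXx] at h
    exact h

end AffineHypersurface

/-! ### Connections agreeing on differentiable fields. -/

section Congruence

variable {E : Type*} [NormedAddCommGroup E] [NormedSpace ℝ E]
  {H : Type*} [TopologicalSpace H] {I : ModelWithCorners ℝ E H}
  {M : Type*} [TopologicalSpace M] [ChartedSpace H M]

/-- The geodesic equation evaluates the connection only on local extensions of vectors, which are
differentiable at the base point. Agreement there is all that duality can give. -/
lemma IsGeodesicallyComplete.congr [IsManifold I 1 M]
    [ContMDiffVectorBundle 1 E (TangentSpace I : M → Type _) I]
    {cov cov' : CovariantDerivative I E (TangentSpace I : M → Type _)}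
    (h : ∀ (Z : ∀ y : M, TangentSpace I y) (x : M), MDiffAt (T% Z) x → cov Z x = cov' Z x)
    (hcov : IsGeodesicallyComplete cov) : IsGeodesicallyComplete cov' := by
  intro x v
  obtain ⟨γ, ⟨hγ, hgeod⟩, h0⟩ := hcov x v
  refine ⟨γ, ⟨hγ, fun t ↦ ?_⟩, h0⟩
  rw [← hgeod t]
  simp only [covDerivAlong]
  rw [h _ _ (FiberBundle.mdifferentiableAt_extend I E _)]

end Congruence

/-- In finite dimension, a bilinear form separating on the left is separating on the right. -/
lemma eq_zero_of_forall_apply_right_eq_zero {V : Type*} [AddCommGroup V] [Module ℝ V]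
    [FiniteDimensional ℝ V] (B : V →ₗ[ℝ] Module.Dual ℝ V)
    (hB : ∀ v, (∀ w, B v w = 0) → v = 0) {w : V} (hw : ∀ v, B v w = 0) : w = 0 := by
  have hinj : Function.Injective B :=
    (injective_iff_map_eq_zero B).2 fun v hv ↦ hB v fun w ↦ by simp [hv]
  have hsurj := (LinearMap.injective_iff_surjective_of_finrank_eq_finrank
    Subspace.dual_finrank_eq.symm).1 hinj
  refine (Module.forall_dual_apply_eq_zero_iff ℝ w).1 fun φ ↦ ?_
  obtain ⟨v, rfl⟩ := hsurj φ
  exact hw v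

/-! ### The conormal hypersurface and the dual connection. -/

namespace AffineHypersurface

variable {n : ℕ} {M : Type*} [TopologicalSpace M] [ChartedSpace (EuclideanSpace ℝ (Fin n)) M]

/-- The conormal vector `ν`, characterized by `⟨ν, f_* v⟩ = 0` and `⟨ν, ξ⟩ = 1`. -/
def conormal (S : AffineHypersurface n M) (x : M) : EuclideanSpace ℝ (Fin (n + 1)) :=
  (InnerProductSpace.toDual ℝ _).symm (S.transversalPart x)

lemma inner_conormal (S : AffineHypersurface n M) (x : M) (w : EuclideanSpace ℝ (Fin (n + 1))) :
    inner ℝ (S.conormal x) w = S.transversalPart x w :=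
  InnerProductSpace.toDual_symm_apply

variable [IsManifold (𝓡 n) ∞ M] (S : AffineHypersurface n M)

lemma contMDiff_conormal :
    ContMDiff (𝓡 n) 𝓘(ℝ, EuclideanSpace ℝ (Fin (n + 1))) ∞ S.conormal := by
  let L : (EuclideanSpace ℝ (Fin (n + 1)) →L[ℝ] ℝ) →ₗ[ℝ] EuclideanSpace ℝ (Fin (n + 1)) :=
    { toFun := (InnerProductSpace.toDual ℝ _).symm
      map_add' := map_add _
      map_smul' := fun a φ ↦ by simp }
  exact (LinearMap.toContinuousLinearMap L).contDiff.comp_contMDiff S.contMDiff_transversalPart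

lemma mdifferentiableAt_conormal (x : M) :
    MDifferentiableAt (𝓡 n) 𝓘(ℝ, EuclideanSpace ℝ (Fin (n + 1))) S.conormal x :=
  S.contMDiff_conormal.mdifferentiable (by simp) x

/-- Differentiate `⟨ν, f_* Z⟩ = 0` for a field `Z` extending `Y`, and insert the Gauss formula. -/
lemma inner_mvfderiv_conormal_push (x : M) (X Y : TangentSpace (𝓡 n) x) :
    inner ℝ (mvfderiv (𝓡 n) S.conormal x X) (S.push x Y) = -S.secondFundamentalForm x Y X := by
  set Z : ∀ y : M, TangentSpace (𝓡 n) y := FiberBundle.extend (EuclideanSpace ℝ (Fin n)) Y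
  have hZ : MDifferentiableAt (𝓡 n) ((𝓡 n).prod 𝓘(ℝ, EuclideanSpace ℝ (Fin n)))
      (fun y ↦ TotalSpace.mk' (EuclideanSpace ℝ (Fin n)) y (Z y)) x :=
    FiberBundle.mdifferentiableAt_extend _ _ _
  have hZx : Z x = Y := FiberBundle.extend_apply_self _ Y
  have h := mvfderiv_inner (S.mdifferentiableAt_conormal x) (S.mdiffAt_pushField hZ) X
  have h0 : (fun y ↦ inner ℝ (S.conormal y) (S.pushField Z y)) = fun _ ↦ (0 : ℝ) := by
    ext1 y
    rw [inner_conormal, pushField, transversalPart_push]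
  have hg : mvfderiv (𝓡 n) (S.pushField Z) x X =
      S.push x (S.inducedConnection Z x X) + S.secondFundamentalForm x (Z x) X • S.ξ x :=
    S.gauss_formula X hZ
  rw [h0, mvfderiv_const, hg, inner_conormal, map_add, map_smul, transversalPart_push,
    transversalPart_ξ, pushField, hZx] at h
  simp only [zero_apply, zero_add, smul_eq_mul, mul_one] at h
  linarith

/-- Differentiate `⟨ν, ξ⟩ = 1`: here `dξ = a f_*` is tangential, so `ν` annihilates it. -/
lemma inner_mvfderiv_conormal_ξ (hS : S.IsCentroaffine) (x : M) (X : TangentSpace (𝓡 n) x) :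
    inner ℝ (mvfderiv (𝓡 n) S.conormal x X) (S.ξ x) = 0 := by
  obtain ⟨c, a, -, hξ⟩ := hS
  have hξd : mvfderiv (𝓡 n) S.ξ x X = a • S.push x X := by
    have h := mvfderiv_comp_of_hasFDerivAt (I := 𝓡 n) (X := X)
      (((hasFDerivAt_id (𝕜 := ℝ) (S.f x)).sub_const c).const_smul a)
      (S.smooth_f.mdifferentiable (by simp) x)
    rw [funext hξ]
    exact h
  have h := mvfderiv_inner (S.mdifferentiableAt_conormal x)
    (S.smooth_ξ.mdifferentiable (by simp) x) X
  have h1 : (fun y ↦ inner ℝ (S.conormal y) (S.ξ y)) = fun _ ↦ (1 : ℝ) := by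
    ext1 y
    rw [inner_conormal, transversalPart_ξ]
  rw [h1, mvfderiv_const, hξd, inner_conormal, map_smul, transversalPart_push, smul_zero,
    add_zero] at h
  exact h.symm

variable {S}

/-- A dimension count moves non-degeneracy to the other slot without using the symmetry of `g`. -/
lemma IsNondegenerate.eq_zero_of_right (hS : S.IsNondegenerate) {x : M}
    {w : TangentSpace (𝓡 n) x} (hw : ∀ v, S.secondFundamentalForm x v w = 0) : w = 0 := by
  have : FiniteDimensional ℝ (TangentSpace (𝓡 n) x) :=
    inferInstanceAs (FiniteDimensional ℝ (EuclideanSpace ℝ (Fin n)))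
  exact eq_zero_of_forall_apply_right_eq_zero
    (ContinuousLinearMap.coeLM ℝ ∘ₗ (S.secondFundamentalForm x).toLinearMap) (hS x) hw

variable (S)

/-- The conormal hypersurface of a non-degenerate centroaffine hypersurface, equipped with its
position vector as the transversal field. -/
def dual (hc : S.IsCentroaffine) (hn : S.IsNondegenerate) : AffineHypersurface n M where
  f := S.conormal
  ξ := S.conormal
  smooth_f := S.contMDiff_conormal
  smooth_ξ := S.contMDiff_conormal
  immersion x := by
    refine (injective_iff_map_eq_zero _).2 fun X hX ↦ hn.eq_zero_of_right fun v ↦ ?_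
    have h := S.inner_mvfderiv_conormal_push x X v
    rw [hX, inner_zero_left] at h
    linarith
  transversal x := by
    rintro ⟨X, hX⟩
    have h := S.inner_mvfderiv_conormal_ξ hc x X
    rw [hX, inner_conormal, transversalPart_ξ] at h
    exact one_ne_zero h

lemma isCentroaffine_dual (hc : S.IsCentroaffine) (hn : S.IsNondegenerate) :
    (S.dual hc hn).IsCentroaffine :=
  ⟨0, 1, one_ne_zero, fun x ↦ by simp [dual]⟩

/-- The induced connection of the conormal hypersurface is dual to the induced connection. -/
theorem isDualConnection_dual (hc : S.IsCentroaffine) (hn : S.IsNondegenerate) :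
    IsDualConnection S.secondFundamentalForm S.inducedConnection
      (S.dual hc hn).inducedConnection := by
  intro x X Y Z hY hZ
  -- Write `g(Y, Z) = -⟨ν_* Z, f_* Y⟩` and differentiate by both Gauss formulas. The transversal
  -- terms drop out because `⟨ν, f_* Y⟩ = 0` and `⟨ν_* Z, ξ⟩ = 0`.
  have hfun : (fun y ↦ S.secondFundamentalForm y (Y y) (Z y)) =
      -fun y ↦ inner ℝ ((S.dual hc hn).pushField Z y) (S.pushField Y y) := by
    ext1 y
    have h := S.inner_mvfderiv_conormal_push y (Z y) (Y y)
    exact neg_eq_iff_eq_neg.1 h.symm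
  have hgY : mvfderiv (𝓡 n) (S.pushField Y) x X =
      S.push x (S.inducedConnection Y x X) + S.secondFundamentalForm x (Y x) X • S.ξ x :=
    S.gauss_formula X hY
  have hgZ : mvfderiv (𝓡 n) ((S.dual hc hn).pushField Z) x X =
      mvfderiv (𝓡 n) S.conormal x ((S.dual hc hn).inducedConnection Z x X) +
        (S.dual hc hn).secondFundamentalForm x (Z x) X • S.conormal x :=
    (S.dual hc hn).gauss_formula X hZ
  have hpZ : (S.dual hc hn).pushField Z x = mvfderiv (𝓡 n) S.conormal x (Z x) := rfl
  have h := mvfderiv_inner ((S.dual hc hn).mdiffAt_pushField hZ) (S.mdiffAt_pushField hY) X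
  rw [hfun, mvfderiv_neg, neg_apply, h, hgY, hgZ, hpZ, inner_add_left,
    inner_add_right, inner_smul_left, inner_smul_right, pushField, inner_mvfderiv_conormal_push,
    inner_mvfderiv_conormal_push, inner_mvfderiv_conormal_ξ S hc, inner_conormal,
    transversalPart_push]
  ring

/-- The dual connection is determined by the duality relation. -/
theorem IsNondegenerate.isDualConnection_unique {S : AffineHypersurface n M}
    (hn : S.IsNondegenerate)
    {cov₁ cov₂ : CovariantDerivative (𝓡 n) (EuclideanSpace ℝ (Fin n))
      (TangentSpace (𝓡 n) : M → Type _)}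
    (h₁ : IsDualConnection S.secondFundamentalForm S.inducedConnection cov₁)
    (h₂ : IsDualConnection S.secondFundamentalForm S.inducedConnection cov₂)
    (Z : ∀ y : M, TangentSpace (𝓡 n) y) (x : M)
    (hZ : MDifferentiableAt (𝓡 n) ((𝓡 n).prod 𝓘(ℝ, EuclideanSpace ℝ (Fin n)))
      (fun y ↦ TotalSpace.mk' (EuclideanSpace ℝ (Fin n)) y (Z y)) x) :
    cov₁ Z x = cov₂ Z x := by
  ext1 X
  refine sub_eq_zero.1 (hn.eq_zero_of_right fun v ↦ ?_)
  have hv : MDifferentiableAt (𝓡 n) ((𝓡 n).prod 𝓘(ℝ, EuclideanSpace ℝ (Fin n)))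
      (fun y ↦ TotalSpace.mk' (EuclideanSpace ℝ (Fin n)) y
        (FiberBundle.extend (EuclideanSpace ℝ (Fin n)) v y)) x :=
    FiberBundle.mdifferentiableAt_extend _ _ _
  have h := (h₁ x X _ Z hv hZ).symm.trans (h₂ x X _ Z hv hZ)
  rw [FiberBundle.extend_apply_self] at h
  rw [map_sub, sub_eq_zero]
  exact add_left_cancel h

end AffineHypersurface

end

theorem theorem5p4 {n : ℕ} {M : Type*} [TopologicalSpace M]
    [ChartedSpace (EuclideanSpace ℝ (Fin n)) M] [IsManifold (𝓡 n) ∞ M]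
    (S : AffineHypersurface n M) (hS : S.IsCentroaffineOvaloid) :
    IsGeodesicallyComplete S.inducedConnection ∧
      (∃ dualConn, IsDualConnection S.secondFundamentalForm S.inducedConnection dualConn) ∧
      ∀ dualConn, IsDualConnection S.secondFundamentalForm S.inducedConnection dualConn →
        IsGeodesicallyComplete dualConn := by
  obtain ⟨⟨φ⟩, hc, hn⟩ := hS
  have : CompactSpace M := φ.toHomeomorph.symm.compactSpace
  have : T2Space M := φ.toHomeomorph.symm.t2Space
  refine ⟨S.isGeodesicallyComplete_inducedConnection hc, ⟨_, S.isDualConnection_dual hc hn⟩,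
    fun cov hcov ↦ ?_⟩
  -- Completeness passes from the conormal connection to an arbitrary dual one by uniqueness.
  exact ((S.dual hc hn).isGeodesicallyComplete_inducedConnection
    (S.isCentroaffine_dual hc hn)).congr
    (hn.isDualConnection_unique (S.isDualConnection_dual hc hn) hcov)
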